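/- Let $k\ge 2$, $d\ge 1$, $t=\lceil\log_2 d\rceil$ and $n\ge 2kdt$. The Boolean function $\mathrm{MXPJ}_{2k,d}:\{0,1\}^n\to\{0,1\}$ (matrix XOR pointer jumping) is defined as follows. The first $2kdt$ input bits are split into $2kd$ consecutive blocks of $t$ bits, each encoding (least significant bit first, reduced modulo $d$) an element of $\{0,\dots,d-1\}$; the blocks list, in this order, the value tables of functions $f_{A,1},\dots,f_{A,k},f_{B,1},\dots,f_{B,k}:\{0,\dots,d-1\}\to\{0,\dots,d-1\}$. The remaining $n-2kdt$ variables are irrelevant. Put $f^{(-1)}=f^{(0)}=0$ and, for $0\le j<2k$, $$f^{(j+1)}=f_{j+1}\bigl(f^{(j)}\bigr)\oplus f^{(j-1)},\qquad f_i=\begin{cases}f_{A,\lceil i/2\rceil}& i\text{ odd},\\ f_{B,\lceil i/2\rceil}& i\text{ even},\end{cases}$$ where $\oplus$ is the bitwise XOR of binary representations, reduced modulo $d$ (the reductions have no effect when $d$ is a power of two). Then $\mathrm{MXPJ}_{2k,d}$ is the parity of the number of ones in the binary representation of $f^{(2k)}$. A probabilistic natural-order $k$-OBDD ($k$-id-POBDD)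 on $n$ variables is a leveled program with $kn$ non-sink levels followed by a level of sinks, made of $k$ layers, each of which tests $x_1,\dots,x_n$ in this order, one variable per level. Computation starts in a source node of the first level; at each non-sink node the next node is chosen in the next level at random, according to a probability distribution depending on the node and on the value of the tested variable. Some sinks are accepting. The width is the maximal number of nodes in a non-sink level. The program computes $f$ with error at most $\tfrac12-\varepsilon$ if it accepts every $x\in f^{-1}(1)$ with probability at least $\tfrac12+\varepsilon$ and every $x\in f^{-1}(0)$ with probability at most $\tfrac12-\varepsilon$. **Statement.** For every $\varepsilon>0$ there is $d_0=d_0(\varepsilon)$ such that for all $d\ge d_0$, all $k\ge 2$ and all $n\ge 2kd\lceil\log_2 d\rceil$, no $k$-id-POBDD of width at most $\sqrt{d/\log_2 k}$ computes $\mathrm{MXPJ}_{2k,d}:\{0,1\}^n\to\{0,1\}$ with error at most $\tfrac12-\varepsilon$. That is, $\mathrm{MXPJ}_{2k,d}\notin k\text{-id-}\mathbf{POBDD}_{\sqrt{d/\log k}}$ for bounded error with a fixed margin $\varepsilon$ and all sufficiently large $d$. -/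

import Mathlib

open scoped BigOperators

/-! ### Probabilistic `k`-OBDDs -/

/-- A probabilistic `k`-OBDD over `n` Boolean variables: `k` consecutive layers, each of which
reads all `n` variables, one per level, in the same order `order`. Levels are numbered
`0, ..., k * n`; level `k * n` consists of the sinks, and level `l < k * n` tests the variable
`order (l mod n)`. At a node `v` of level `l` with tested bit `b` the program moves to a random node
of the next level, chosen by the probability vector `trans l b v`. -/
structure POBDD (k n : ℕ) where
  /-- the number of nodes of each level -/
  size : Fin (k * n + 1) → ℕ
  /-- the order in which every layer tests the variables -/
  order : Equiv.Perm (Fin n)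
  /-- the source node -/
  source : Fin (size 0)
  /-- transition probabilities -/
  trans : (l : Fin (k * n)) → Bool → Fin (size l.castSucc) → Fin (size l.succ) → ℝ
  trans_mem : ∀ l b v, trans l b v ∈ stdSimplex ℝ (Fin (size l.succ))
  /-- the accepting sinks -/
  accept : Finset (Fin (size (Fin.last (k * n))))

namespace POBDD

variable {k n : ℕ}

/-- The width: the maximal number of nodes of a non-sink level. -/
def width (P : POBDD k n) : ℕ :=
  Finset.univ.sup fun l : Fin (k * n) => P.size l.castSucc

/-- The variable tested at level `l`. -/
def var (P : POBDD k n) (l : Fin (k * n)) : Fin n := P.order l.modNat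

/-- `P.dist x l v` is the probability that the computation on input `x` is at node `v` when it
reaches level `l`. -/
noncomputable def dist (P : POBDD k n) (x : Fin n → Bool) (l : Fin (k * n + 1)) :
    Fin (P.size l) → ℝ :=
  Fin.induction (motive := fun l => Fin (P.size l) → ℝ)
    (Pi.single P.source 1)
    (fun l p u => ∑ v, p v * P.trans l (x (P.var l)) v u) l

/-- The probability that `P` accepts the input `x`. -/
noncomputable def acceptProb (P : POBDD k n) (x : Fin n → Bool) : ℝ :=
  ∑ v ∈ P.accept, P.dist x (Fin.last (k * n)) v

/-- `P` computes `f` with error at most `1 / 2 - ε`. -/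
def ComputesWithError (P : POBDD k n) (f : (Fin n → Bool) → Bool) (ε : ℝ) : Prop :=
  ∀ x, (f x = true → 1 / 2 + ε ≤ P.acceptProb x) ∧ (f x = false → P.acceptProb x ≤ 1 / 2 - ε)

end POBDD

/-- The Boolean functions of `n` variables which are computed, with error at most `1 / 2 - ε`, by
some probabilistic `k`-OBDD with the natural order of the variables and of width at most `w`. -/
def kIdPOBDD (k n : ℕ) (w ε : ℝ) : Set ((Fin n → Bool) → Bool) :=
  {f | ∃ P : POBDD k n, P.order = 1 ∧ (P.width : ℝ) ≤ w ∧ P.ComputesWithError f ε}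

/-! ### Matrix XOR pointer jumping -/

/-- Pointer jumping with XOR on the vertices `0, ..., d - 1` of both sides, from `v₀ = 0`. The value
at `j` is the pair `(f^(j), f^(j-1))`, with `f^(-1) = 0`. Step `j + 1` applies the function number
`j / 2` (counted from `0`) of the family `fA` if `j + 1` is odd and of the family `fB` if `j + 1` is
even, and then takes the bitwise XOR with `f^(j-1)`; the reduction modulo `d` has an effect only
if `d` is not a power of two. -/
def xmpjIter (d : ℕ) (fA fB : ℕ → ℕ → ℕ) : ℕ → ℕ × ℕ
  | 0 => (0, 0)
  | j + 1 =>
    let p := xmpjIter d fA fB j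
    (((if Even j then fA (j / 2) p.1 else fB (j / 2) p.1) ^^^ p.2) % d, p.1)

/-- Bit number `m` of the input. -/
def inputBit {n : ℕ} (x : Fin n → Bool) (m : ℕ) : Bool :=
  if h : m < n then x ⟨m, h⟩ else false

/-- The integer modulo `d` that is written, least significant bit first, in block number `p` of the
input, where the blocks consist of `⌈log₂ d⌉` bits. -/
def blockVal (d : ℕ) {n : ℕ} (x : Fin n → Bool) (p : ℕ) : ℕ :=
  (∑ b ∈ Finset.range (Nat.clog 2 d),
    (inputBit x (p * Nat.clog 2 d + b)).toNat * 2 ^ b) % d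

/-- The Boolean function `MXPJ_{2k,d}` on `n ≥ 2 k d ⌈log₂ d⌉` variables. The input lists
the tables of `f_{A,1}, ..., f_{A,k}` and then those of `f_{B,1}, ..., f_{B,k}`, one block for each
table entry, possibly followed by unused variables. The value is the parity of the binary
representation of `f^(2k)`. -/
def MXPJ (k d n : ℕ) (x : Fin n → Bool) : Bool :=
  let fA : ℕ → ℕ → ℕ := fun i v => blockVal d x (i * d + v)
  let fB : ℕ → ℕ → ℕ := fun i v => blockVal d x (k * d + (i * d + v))
  decide (Odd (Nat.digits 2 (xmpjIter d fA fB (2 * k)).1).sum)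

open scoped BigOperators

/-! ### Pointer jumping -/

/-! Cut the input after the first player's tables, at position `c = k * d * Nat.clog 2 d`. Every
layer of a natural-order program reads these bits before all others, so the first player acts on the
computation only through `k` substochastic matrices, and in the first layer only through the row of
the source. For width `w` these are `w + (k - 1) * w ^ 2` numbers. Round each down to a multiple of
`1 / M`. If two choices of first-player tables have the same rounding, then for every choice of
second-player tables the acceptance probabilities differ by at most `k * w / M`: each layer adds at
most `w / M` to the ℓ¹ distance, and substochastic matrices never increase it
(`abs_acceptProb_sub_le_of_close`). The precision `M` makes this less than `2 * ε`.

The count uses first-player tables that vanish in the first function and at the vertices `0` and `d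
- 1`, with values below `2 ^ Nat.log 2 d`, so that reductions modulo `d` are harmless. The logarithm
of their number is about `(k - 1) * d * log d`. Since `w ^ 2 * log k ≤ d`, the logarithm of the
number of roundings is only about half of this, up to terms of order `(k - 1) * d` with a constant
depending on `ε` (`exists_pow_precision_lt`). Hence two different tables collide for large `d`. But
some second-player tables give them opposite function values (`exists_tables_parity_ne`), which
forces a gap of at least `2 * ε`. -/

theorem xmpjIter_fst_lt {d : ℕ} (hd : 0 < d) (fA fB : ℕ → ℕ → ℕ) (j : ℕ) :
    (xmpjIter d fA fB j).1 < d := by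
  cases j with
  | zero => exact hd
  | succ j => exact Nat.mod_lt _ hd

theorem xmpjIter_congr {d k : ℕ} (hd : 0 < d) {fA fB gA gB : ℕ → ℕ → ℕ}
    (hA : ∀ i < k, ∀ v < d, fA i v = gA i v) (hB : ∀ i < k, ∀ v < d, fB i v = gB i v) :
    ∀ j ≤ 2 * k, xmpjIter d fA fB j = xmpjIter d gA gB j := by
  intro j
  induction j with
  | zero => intro _; rfl
  | succ j ih =>
    intro hj
    have h := ih (by omega)
    have hlt := xmpjIter_fst_lt hd gA gB j
    have hk : j / 2 < k := by omega
    simp only [xmpjIter, h, hA _ hk _ hlt, hB _ hk _ hlt]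

theorem xmpjIter_two_mul_add_one (d : ℕ) (fA fB : ℕ → ℕ → ℕ) {i a b : ℕ}
    (h : xmpjIter d fA fB (2 * i) = (a, b)) :
    xmpjIter d fA fB (2 * i + 1) = ((fA i a ^^^ b) % d, a) := by
  simp [xmpjIter, h]

theorem xmpjIter_two_mul_add_two (d : ℕ) (fA fB : ℕ → ℕ → ℕ) {i a b : ℕ}
    (h : xmpjIter d fA fB (2 * i + 1) = (a, b)) :
    xmpjIter d fA fB (2 * (i + 1)) = ((fB i a ^^^ b) % d, a) := by
  have h2 : (2 * i + 1) / 2 = i := by omega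
  have h1 : ¬ Even (2 * i + 1) := by simp
  rw [show 2 * (i + 1) = (2 * i + 1) + 1 by ring]
  conv_lhs => rw [xmpjIter]
  simp only [h, h1, h2, if_false]

/-- The XOR of `f i`, `i = i₀, ..., i₀ + s - 1`. -/
def xorSum (f : ℕ → ℕ) (i₀ : ℕ) : ℕ → ℕ
  | 0 => 0
  | s + 1 => f (i₀ + s) ^^^ xorSum f i₀ s

theorem xorSum_lt {f : ℕ → ℕ} {m : ℕ} (hf : ∀ i, f i < 2 ^ m) (i₀ s : ℕ) :
    xorSum f i₀ s < 2 ^ m := by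
  induction s with
  | zero => exact Nat.two_pow_pos m
  | succ s ih => exact Nat.xor_lt_two_pow (hf _) ih

/-- Only the first terms differ, and XOR with equal later terms is injective. -/
theorem xorSum_ne {f g : ℕ → ℕ} {i₀ : ℕ} (h₀ : f i₀ ≠ g i₀) (h : ∀ i, i₀ < i → f i = g i) (s : ℕ) :
    xorSum f i₀ (s + 1) ≠ xorSum g i₀ (s + 1) := by
  induction s with
  | zero => simpa [xorSum] using h₀
  | succ s ih =>
    rw [xorSum, xorSum.eq_2 g, h (i₀ + (s + 1)) (by omega)]
    exact fun e => ih (Nat.xor_right_injective e)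

/-- Second-player tables that steer the computation to the vertex `v` in step `2 (i₁ + 1)`, keep it
there, and in the last step flip the lowest bit if the last vertex of the first player is `u`. -/
def steer (k i₁ v u : ℕ) (j y : ℕ) : ℕ :=
  if j = i₁ then v else if j + 1 = k ∧ y = u then 1 else 0

theorem xmpjIter_steer_before {d k i₁ v u : ℕ} {fA : ℕ → ℕ → ℕ} (hi : i₁ + 1 < k)
    (h0 : ∀ i, fA i 0 = 0) : ∀ i ≤ i₁, xmpjIter d fA (steer k i₁ v u) (2 * i) = (0, 0) := by
  intro i
  induction i with
  | zero => intro _; rfl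
  | succ i ih =>
    intro h
    rw [xmpjIter_two_mul_add_two d fA _ (xmpjIter_two_mul_add_one d fA _ (ih (by omega)))]
    have h1 : i ≠ i₁ := by omega
    have h2 : i + 1 ≠ k := by omega
    simp [h0, steer, h1, h2]

/-- While the second player answers `0`, the XOR with the previous vertex returns the computation to
`v`, and the first player's vertex accumulates the XOR of the values at `v`. These stay below `2 ^ m
≤ d`, so no reduction takes effect. -/
theorem xmpjIter_steer_after {d k i₁ v u m : ℕ} {fA : ℕ → ℕ → ℕ} (hm : 2 ^ m ≤ d)
    (h0 : ∀ i, fA i 0 = 0) (hv : v < d) (hf : ∀ i, fA i v < 2 ^ m) :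
    ∀ s, i₁ + 1 + s < k → xmpjIter d fA (steer k i₁ v u) (2 * (i₁ + 1 + s)) =
      (v, xorSum (fun i => fA i v) (i₁ + 1) s) := by
  intro s
  induction s with
  | zero =>
    intro h
    rw [add_zero, xmpjIter_two_mul_add_two d fA _ (xmpjIter_two_mul_add_one d fA _
      (xmpjIter_steer_before h h0 i₁ le_rfl))]
    simp [h0, steer, xorSum, Nat.mod_eq_of_lt hv]
  | succ s ih =>
    intro h
    rw [← add_assoc, xmpjIter_two_mul_add_two d fA _ (xmpjIter_two_mul_add_one d fA _
      (ih (by omega)))]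
    have h1 : i₁ + 1 + s ≠ i₁ := by omega
    have h2 : i₁ + 1 + s + 1 ≠ k := by omega
    have h3 := (xorSum_lt hf (i₁ + 1) (s + 1)).trans_le hm
    simp only [xorSum] at h3
    simp [steer, xorSum, Nat.mod_eq_of_lt hv, h1, h2, Nat.mod_eq_of_lt h3]

/-- Excluding `v = d - 1` keeps `1 ^^^ v` below `d`; otherwise, for odd `d`, the flipped vertex
would be `d` and reduce to `0`. -/
theorem xmpjIter_steer_last {d i₁ v u m s : ℕ} {fA : ℕ → ℕ → ℕ} (hm : 2 ^ m ≤ d)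
    (h0 : ∀ i, fA i 0 = 0) (hv : v + 1 < d) (hf : ∀ i, fA i v < 2 ^ m) :
    (xmpjIter d fA (steer (i₁ + 1 + s + 1) i₁ v u) (2 * (i₁ + 1 + s + 1))).1 =
      if xorSum (fun i => fA i v) (i₁ + 1) (s + 1) = u then 1 ^^^ v else v := by
  have h3 := (xorSum_lt hf (i₁ + 1) (s + 1)).trans_le hm
  rw [xmpjIter_two_mul_add_two d fA _ (xmpjIter_two_mul_add_one d fA _
      (xmpjIter_steer_after hm h0 (by omega) hf s (by omega)))]
  simp only [xorSum] at h3
  have h1 : i₁ + 1 + s ≠ i₁ := by omega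
  have h4 : 1 ^^^ v < d := by
    have := Nat.xor_mod_two_eq (m := 1) (n := v)
    have h5 : (1 ^^^ v) / 2 = v / 2 := by simp [Nat.xor_div_two]
    omega
  simp only [steer, xorSum, h1, Nat.mod_eq_of_lt h3, if_false, true_and]
  by_cases hu : fA (i₁ + 1 + s) v ^^^ xorSum (fun i => fA i v) (i₁ + 1) s = u
  · simp [hu, Nat.mod_eq_of_lt h4]
  · simp [hu, Nat.mod_eq_of_lt (show v < d by omega)]

theorem odd_digits_sum_one_xor (v : ℕ) :
    Odd (Nat.digits 2 (1 ^^^ v)).sum ↔ ¬ Odd (Nat.digits 2 v).sum := by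
  have key : ∀ a, (Nat.digits 2 a).sum = a % 2 + (Nat.digits 2 (a / 2)).sum := by
    intro a
    rcases Nat.eq_zero_or_pos a with rfl | ha
    · simp
    · rw [Nat.digits_def' one_lt_two ha]; simp
  have h5 : (1 ^^^ v) / 2 = v / 2 := by simp [Nat.xor_div_two]
  have := Nat.xor_mod_two_eq (m := 1) (n := v)
  rw [key (1 ^^^ v), key v, h5, Nat.odd_iff, Nat.odd_iff]
  omega

/-- Different first-player tables are told apart by some second-player tables. -/
theorem exists_tables_parity_ne {d k m : ℕ} {fA gA : ℕ → ℕ → ℕ} (hm : 2 ^ m ≤ d)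
    (hf0 : ∀ i, fA i 0 = 0) (hg0 : ∀ i, gA i 0 = 0) (hf : ∀ i v, fA i v < 2 ^ m)
    (hg : ∀ i v, gA i v < 2 ^ m) (hfg0 : fA 0 = gA 0) (hfgk : ∀ i, k ≤ i → fA i = gA i)
    (hfgd : ∀ i v, d ≤ v + 1 → fA i v = gA i v) (hne : fA ≠ gA) :
    ∃ fB : ℕ → ℕ → ℕ, (∀ i v, fB i v < d) ∧
      (Odd (Nat.digits 2 (xmpjIter d fA fB (2 * k)).1).sum ↔
        ¬ Odd (Nat.digits 2 (xmpjIter d gA fB (2 * k)).1).sum) := by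
  classical
  have hex : ∃ i, fA i ≠ gA i := Function.ne_iff.mp hne
  have hlt : ∀ i, fA i ≠ gA i → i < k := fun i h => lt_of_not_ge fun h' => h (hfgk i h')
  obtain ⟨i, hi⟩ := hex
  -- With the last differing index, no later difference can cancel the one at `i₀` in the
  -- accumulated XOR.
  let i₀ := Nat.findGreatest (fun i => fA i ≠ gA i) k
  have h₀ : fA i₀ ≠ gA i₀ :=
    Nat.findGreatest_spec (P := fun i => fA i ≠ gA i) (hlt i hi).le hi
  have hgt : ∀ i, i₀ < i → fA i = gA i := fun j hj => by
    by_contra hc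
    exact Nat.findGreatest_is_greatest hj (hlt j hc).le hc
  -- The second player needs one move before index `i₀` to steer to `v`; this is the move `i₁ = i₀ -
  -- 1`.
  have hpos : i₀ ≠ 0 := fun h => h₀ (by rw [h, hfg0])
  have hlk := hlt i₀ h₀
  obtain ⟨v, hv⟩ := Function.ne_iff.mp h₀
  have hvd : v + 1 < d := lt_of_not_ge fun h => hv (hfgd i₀ v h)
  obtain ⟨i₁, hi₁⟩ := Nat.exists_eq_succ_of_ne_zero hpos
  obtain ⟨s, hs⟩ := Nat.exists_eq_add_of_lt hlk
  rw [hi₁] at hs h₀ hgt hv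
  simp only [Nat.succ_eq_add_one] at hs h₀ hgt hv
  subst hs
  refine ⟨steer (i₁ + 1 + s + 1) i₁ v (xorSum (fun i => fA i v) (i₁ + 1) (s + 1)), fun j y => ?_, ?_⟩
  · unfold steer
    split_ifs <;> omega
  · rw [xmpjIter_steer_last hm hf0 hvd (fun i => hf i v),
      xmpjIter_steer_last hm hg0 hvd (fun i => hg i v), if_pos rfl,
      if_neg (xorSum_ne (f := fun i => fA i v) (g := fun i => gA i v) hv
        (fun i h => by simp only [hgt i h]) s).symm]
    exact odd_digits_sum_one_xor v

/-! ### Encoding tables as inputs -/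

/-- The input whose block number `p` encodes `τ p`. -/
def encode (d n : ℕ) (τ : ℕ → ℕ) (m : Fin n) : Bool :=
  (τ (m / Nat.clog 2 d)).testBit (m % Nat.clog 2 d)

theorem inputBit_encode {d n m : ℕ} (τ : ℕ → ℕ) (h : m < n) :
    inputBit (encode d n τ) m = (τ (m / Nat.clog 2 d)).testBit (m % Nat.clog 2 d) := by
  simp [inputBit, encode, h]

theorem sum_testBit_mul_two_pow (a t : ℕ) :
    ∑ b ∈ Finset.range t, (a.testBit b).toNat * 2 ^ b = a % 2 ^ t := by
  induction t with
  | zero => simp [Nat.mod_one]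
  | succ t ih =>
    rw [Finset.sum_range_succ, ih, Nat.mod_pow_succ, Nat.testBit_eq_decide_div_mod_eq]
    rcases Nat.mod_two_eq_zero_or_one (a / 2 ^ t) with h | h <;> simp [h]

theorem blockVal_encode {d n p : ℕ} {τ : ℕ → ℕ} (hd : 2 ≤ d) (hp : (p + 1) * Nat.clog 2 d ≤ n)
    (hτ : τ p < d) : blockVal d (encode d n τ) p = τ p := by
  have ht : 0 < Nat.clog 2 d := Nat.clog_pos one_lt_two hd
  have h2 : d ≤ 2 ^ Nat.clog 2 d := Nat.le_pow_clog one_lt_two d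
  unfold blockVal
  generalize htt : Nat.clog 2 d = t at *
  have : ∀ b ∈ Finset.range t, (inputBit (encode d n τ) (p * t + b)).toNat * 2 ^ b =
      ((τ p).testBit b).toNat * 2 ^ b := by
    intro b hb
    have hb := Finset.mem_range.mp hb
    have e1 : (p * t + b) / t = p := by
      rw [mul_comm, Nat.mul_add_div ht, Nat.div_eq_of_lt hb, add_zero]
    have e2 : (p * t + b) % t = b := by
      rw [mul_comm, Nat.mul_add_mod, Nat.mod_eq_of_lt hb]
    rw [inputBit_encode τ (by nlinarith), htt, e1, e2]
  rw [Finset.sum_congr rfl this, sum_testBit_mul_two_pow, Nat.mod_eq_of_lt (hτ.trans_le h2),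
    Nat.mod_eq_of_lt hτ]

/-- The list of the tables of both players. -/
def tables (k d : ℕ) (fA fB : ℕ → ℕ → ℕ) (p : ℕ) : ℕ :=
  if p < k * d then fA (p / d) (p % d) else fB ((p - k * d) / d) ((p - k * d) % d)

theorem MXPJ_encode_tables {k d n : ℕ} (hd : 2 ≤ d) (hn : 2 * k * d * Nat.clog 2 d ≤ n)
    {fA fB : ℕ → ℕ → ℕ} (hA : ∀ i v, fA i v < d) (hB : ∀ i v, fB i v < d) :
    MXPJ k d n (encode d n (tables k d fA fB)) =
      decide (Odd (Nat.digits 2 (xmpjIter d fA fB (2 * k)).1).sum) := by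
  have hd0 : 0 < d := by omega
  have hT : ∀ p, tables k d fA fB p < d := fun p => by
    unfold tables; split_ifs; exacts [hA _ _, hB _ _]
  have hdiv : ∀ i v, v < d → (i * d + v) / d = i ∧ (i * d + v) % d = v := fun i v hv => by
    rw [mul_comm, Nat.mul_add_div hd0, Nat.div_eq_of_lt hv, Nat.mul_add_mod, Nat.mod_eq_of_lt hv]
    simp
  have hle : ∀ i v, i < k → v < d → i * d + v + 1 ≤ k * d := fun i v hi hv => by
    have : (i + 1) * d ≤ k * d := Nat.mul_le_mul_right _ hi
    linarith [add_mul i 1 d]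
  have hblock : ∀ p, p + 1 ≤ 2 * k * d →
      blockVal d (encode d n (tables k d fA fB)) p = tables k d fA fB p := fun p hp =>
    blockVal_encode hd ((Nat.mul_le_mul_right _ hp).trans hn) (hT p)
  unfold MXPJ
  simp only
  rw [xmpjIter_congr hd0 (gA := fA) (gB := fB) (k := k) _ _ _ le_rfl]
  · intro i hi v hv
    have h := hle i v hi hv
    rw [hblock _ (by linarith [Nat.zero_le (k * d)]), tables, if_pos (by omega), (hdiv i v hv).1, (hdiv i v hv).2]
  · intro i hi v hv
    have h := hle i v hi hv
    rw [hblock _ (by linarith), tables, if_neg (by omega), Nat.add_sub_cancel_left,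
      (hdiv i v hv).1, (hdiv i v hv).2]

theorem inputBit_encode_tables_left {k d n m : ℕ} (fA fB gB : ℕ → ℕ → ℕ)
    (hm : m < k * d * Nat.clog 2 d) :
    inputBit (encode d n (tables k d fA fB)) m = inputBit (encode d n (tables k d fA gB)) m := by
  have h : m / Nat.clog 2 d < k * d := Nat.div_lt_of_lt_mul (by rwa [mul_comm])
  simp [inputBit, encode, tables, h]

/-- The irrelevant variables are also filled from `fB`, so the agreement extends to all positions
after the cut. -/
theorem inputBit_encode_tables_right {k d n m : ℕ} (hd : 2 ≤ d) (fA gA fB : ℕ → ℕ → ℕ)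
    (hm : k * d * Nat.clog 2 d ≤ m) :
    inputBit (encode d n (tables k d fA fB)) m = inputBit (encode d n (tables k d gA fB)) m := by
  have h : ¬ m / Nat.clog 2 d < k * d :=
    not_lt.mpr ((Nat.le_div_iff_mul_le (Nat.clog_pos one_lt_two hd)).mpr hm)
  simp [inputBit, encode, tables, h]
-- Substochastic matrices and the ℓ¹ distance
/-- Nonnegative entries and row sums at most one. -/
structure SubStochastic {ι : Type*} [Fintype ι] (A : Matrix ι ι ℝ) : Prop where
  nonneg : ∀ i j, 0 ≤ A i j
  sum_le : ∀ i, ∑ j, A i j ≤ 1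

namespace SubStochastic

open Matrix

variable {ι : Type*} [Fintype ι] {A B : Matrix ι ι ℝ}

theorem le_one (hA : SubStochastic A) (i j : ι) : A i j ≤ 1 :=
  (Finset.single_le_sum (fun j _ => hA.nonneg i j) (Finset.mem_univ j)).trans (hA.sum_le i)

theorem one [DecidableEq ι] : SubStochastic (1 : Matrix ι ι ℝ) where
  nonneg i j := by rw [Matrix.one_apply]; split_ifs <;> norm_num
  sum_le i := by simp [Matrix.one_apply]

theorem mul (hA : SubStochastic A) (hB : SubStochastic B) : SubStochastic (A * B) where
  nonneg i j := by
    rw [Matrix.mul_apply]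
    exact Finset.sum_nonneg fun l _ => mul_nonneg (hA.nonneg _ _) (hB.nonneg _ _)
  sum_le i := by
    simp only [Matrix.mul_apply]
    rw [Finset.sum_comm]
    refine le_trans (Finset.sum_le_sum fun l _ => ?_) (hA.sum_le i)
    rw [← Finset.mul_sum]
    exact mul_le_of_le_one_right (hA.nonneg _ _) (hB.sum_le l)

theorem sum_abs_vecMul_le (hA : SubStochastic A) (p : ι → ℝ) :
    ∑ j, |(p ᵥ* A) j| ≤ ∑ i, |p i| := by
  calc ∑ j, |(p ᵥ* A) j| ≤ ∑ j, ∑ i, |p i| * A i j := by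
        refine Finset.sum_le_sum fun j _ => (Finset.abs_sum_le_sum_abs _ _).trans_eq ?_
        exact Finset.sum_congr rfl fun i _ => by rw [abs_mul, abs_of_nonneg (hA.nonneg i j)]
    _ = ∑ i, |p i| * ∑ j, A i j := by
        rw [Finset.sum_comm]; simp only [Finset.mul_sum]
    _ ≤ ∑ i, |p i| := Finset.sum_le_sum fun i _ =>
        mul_le_of_le_one_right (abs_nonneg _) (hA.sum_le i)

/-- The distance of two distributions after one step with two matrices that are close on the
support of the second distribution. -/
theorem sum_abs_vecMul_sub_le (hA : SubStochastic A) {p q : ι → ℝ} {δ : ℝ} (hδ : 0 ≤ δ)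
    (hq : ∑ i, |q i| ≤ 1) (hAB : ∀ i, q i ≠ 0 → ∑ j, |A i j - B i j| ≤ δ) :
    ∑ j, |(p ᵥ* A - q ᵥ* B) j| ≤ ∑ i, |(p - q) i| + δ := by
  -- The old error passes through `A`, which contracts; the new error is weighted by `q` alone.
  have e : p ᵥ* A - q ᵥ* B = (p - q) ᵥ* A + q ᵥ* (A - B) := by
    rw [Matrix.sub_vecMul, Matrix.vecMul_sub]; abel
  have h2 : ∑ j, |(q ᵥ* (A - B)) j| ≤ δ := by
    calc ∑ j, |(q ᵥ* (A - B)) j| ≤ ∑ j, ∑ i, |q i| * |A i j - B i j| := by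
          refine Finset.sum_le_sum fun j _ => (Finset.abs_sum_le_sum_abs _ _).trans_eq ?_
          exact Finset.sum_congr rfl fun i _ => abs_mul (q i) (A i j - B i j)
      _ = ∑ i, |q i| * ∑ j, |A i j - B i j| := by
          rw [Finset.sum_comm]; simp only [Finset.mul_sum]
      _ ≤ ∑ i, |q i| * δ := Finset.sum_le_sum fun i _ => by
          by_cases h : q i = 0
          · simp [h]
          · exact mul_le_mul_of_nonneg_left (hAB i h) (abs_nonneg _)
      _ ≤ δ := by
          rw [← Finset.sum_mul]; exact mul_le_of_le_one_left hδ hq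
  rw [e]
  calc _ ≤ ∑ j, (|((p - q) ᵥ* A) j| + |(q ᵥ* (A - B)) j|) :=
        Finset.sum_le_sum fun j _ => abs_add_le _ _
    _ ≤ _ := by
        rw [Finset.sum_add_distrib]
        exact add_le_add (hA.sum_abs_vecMul_le _) h2

end SubStochastic

theorem sum_fin_dite {s W : ℕ} (h : s ≤ W) (g : Fin s → ℝ) :
    ∑ v : Fin W, (if hv : (v : ℕ) < s then g ⟨v, hv⟩ else 0) = ∑ v, g v := by
  have e1 := Fin.sum_univ_eq_sum_range (fun v => if hv : v < s then g ⟨v, hv⟩ else 0) W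
  have e2 := Fin.sum_univ_eq_sum_range (fun v => if hv : v < s then g ⟨v, hv⟩ else 0) s
  rw [e1, ← Finset.sum_subset (Finset.range_subset_range.mpr h), ← e2]
  · exact Finset.sum_congr rfl fun v _ => by simp
  · intro v _ hv
    simp only [Finset.mem_range] at hv
    simp [hv]

/-! ### Programs as products of matrices, and the layer-by-layer comparison -/

namespace POBDD

open Matrix

variable {k n : ℕ} (P : POBDD k n)

/-- A common bound for the sizes of all levels, including the sinks. -/
def bound : ℕ := P.width + P.size (Fin.last (k * n))

theorem size_le_width (l : ℕ) (hl : l < k * n) : P.size ⟨l, by omega⟩ ≤ P.width :=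
  Finset.le_sup (f := fun l : Fin (k * n) => P.size l.castSucc)
    (Finset.mem_univ (⟨l, hl⟩ : Fin (k * n)))

theorem size_le_bound (l : Fin (k * n + 1)) : P.size l ≤ P.bound := by
  by_cases h : (l : ℕ) < k * n
  · exact (P.size_le_width l h).trans (Nat.le_add_right _ _)
  · have : l = Fin.last (k * n) := by ext; simp; omega
    subst this
    exact Nat.le_add_left _ _

/-- The transition matrix of level `l` for the tested bit `b`, padded with zeros. -/
def step (l : ℕ) (b : Bool) : Matrix (Fin P.bound) (Fin P.bound) ℝ := fun v u =>
  if h : l < k * n then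
    if hv : (v : ℕ) < P.size ⟨l, by omega⟩ then
      if hu : (u : ℕ) < P.size ⟨l + 1, by omega⟩ then P.trans ⟨l, h⟩ b ⟨v, hv⟩ ⟨u, hu⟩ else 0
    else 0
  else 0

theorem step_subStochastic (l : ℕ) (b : Bool) : SubStochastic (P.step l b) where
  nonneg v u := by
    unfold step
    split_ifs
    · exact (P.trans_mem _ _ _).1 _
    all_goals rfl
  sum_le v := by
    unfold step
    split_ifs with h hv
    · exact (sum_fin_dite (P.size_le_bound _) (P.trans ⟨l, h⟩ b ⟨v, hv⟩)).trans_le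
        (P.trans_mem _ _ _).2.le
    all_goals simp

/-- The product of the transition matrices of `m` consecutive levels, starting with level `l`. -/
def steps (x : Fin n → Bool) (l : ℕ) : ℕ → Matrix (Fin P.bound) (Fin P.bound) ℝ
  | 0 => 1
  | m + 1 => steps x l m * P.step (l + m) (inputBit x ((l + m) % n))

theorem steps_subStochastic (x : Fin n → Bool) (l m : ℕ) : SubStochastic (P.steps x l m) := by
  induction m with
  | zero => exact SubStochastic.one
  | succ m ih => exact ih.mul (P.step_subStochastic _ _)

theorem steps_congr {x y : Fin n → Bool} {l m : ℕ}
    (h : ∀ i < m, inputBit x ((l + i) % n) = inputBit y ((l + i) % n)) :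
    P.steps x l m = P.steps y l m := by
  induction m with
  | zero => rfl
  | succ m ih =>
    rw [steps, steps, ih fun i hi => h i (by omega), h m (by omega)]

/-- The first factor already has zero rows in the padding. With no steps the product is the
identity, hence `0 < m`. -/
theorem steps_apply_eq_zero_left (x : Fin n → Bool) {l m : ℕ} (hm : 0 < m) (hl : l < k * n)
    {v : Fin P.bound} (hv : P.width ≤ v) (u : Fin P.bound) : P.steps x l m v u = 0 := by
  obtain ⟨m, rfl⟩ := Nat.exists_eq_succ_of_ne_zero hm.ne'
  induction m generalizing u with
  | zero =>
    have : ¬ (v : ℕ) < P.size ⟨l, by omega⟩ := not_lt.mpr ((P.size_le_width l hl).trans hv)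
    simp [steps, step, this]
  | succ m ih =>
    rw [steps, Matrix.mul_apply]
    exact Finset.sum_eq_zero fun j _ => mul_eq_zero_of_left (ih j (by omega)) _

theorem steps_apply_eq_zero_right (x : Fin n → Bool) {l m : ℕ} (hm : 0 < m) (hl : l + m < k * n)
    (v : Fin P.bound) {u : Fin P.bound} (hu : P.width ≤ u) : P.steps x l m v u = 0 := by
  obtain ⟨m, rfl⟩ := Nat.exists_eq_succ_of_ne_zero hm.ne'
  have : ¬ (u : ℕ) < P.size ⟨l + m + 1, by omega⟩ :=
    not_lt.mpr ((P.size_le_width _ hl).trans hu)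
  rw [steps, Matrix.mul_apply]
  exact Finset.sum_eq_zero fun j _ => by simp [step, this]

/-- The distribution at level `l`, padded with zeros. -/
noncomputable def padDist (x : Fin n → Bool) (l : ℕ) : Fin P.bound → ℝ := fun v =>
  if h : l < k * n + 1 then
    if hv : (v : ℕ) < P.size ⟨l, h⟩ then P.dist x ⟨l, h⟩ ⟨v, hv⟩ else 0
  else 0

theorem dist_succ (x : Fin n → Bool) (l : Fin (k * n)) (u : Fin (P.size l.succ)) :
    P.dist x l.succ u = ∑ v, P.dist x l.castSucc v * P.trans l (x (P.var l)) v u := by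
  simp only [dist, Fin.induction_succ]

theorem padDist_succ (hP : P.order = 1) (x : Fin n → Bool) {l : ℕ} (hl : l < k * n) :
    P.padDist x (l + 1) = P.padDist x l ᵥ* P.step l (inputBit x (l % n)) := by
  have hn : 0 < n := Nat.pos_of_ne_zero fun h => by simp [h] at hl
  have hb : inputBit x (l % n) = x (P.var ⟨l, hl⟩) := by
    rw [inputBit, dif_pos (Nat.mod_lt _ hn), var, hP]
    rfl
  rw [hb]
  funext u
  simp only [Matrix.vecMul, dotProduct, padDist, step]
  rw [dif_pos (show l + 1 < k * n + 1 by omega)]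
  by_cases hu : (u : ℕ) < P.size ⟨l + 1, by omega⟩
  · rw [dif_pos hu]
    refine (P.dist_succ x ⟨l, hl⟩ ⟨u, hu⟩).trans ?_
    refine (sum_fin_dite (P.size_le_bound _) _).symm.trans ?_
    refine Finset.sum_congr rfl fun v _ => ?_
    rw [dif_pos (show l < k * n + 1 by omega), dif_pos hl]
    by_cases hv : (v : ℕ) < P.size ⟨l, by omega⟩
    · simp only [Fin.castSucc_mk, hv, hu, dif_pos]
    · simp only [Fin.castSucc_mk, hv, dif_neg, not_false_eq_true, mul_zero]
  · simp [hu]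

theorem padDist_add (hP : P.order = 1) (x : Fin n → Bool) {l m : ℕ} (hl : l + m ≤ k * n) :
    P.padDist x (l + m) = P.padDist x l ᵥ* P.steps x l m := by
  induction m with
  | zero => simp [steps]
  | succ m ih =>
    rw [← add_assoc, P.padDist_succ hP x (by omega), ih (by omega), steps, Matrix.vecMul_vecMul]

theorem padDist_zero (x : Fin n → Bool) :
    P.padDist x 0 = Pi.single (Fin.castLE (P.size_le_bound 0) P.source) 1 := by
  funext v
  have hd : P.dist x 0 = Pi.single P.source 1 := rfl
  unfold padDist
  rw [dif_pos (by omega)]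
  by_cases hv : (v : ℕ) < P.size 0
  · rw [dif_pos (by exact hv)]
    change P.dist x 0 ⟨v, hv⟩ = _
    rw [hd]
    simp [Pi.single_apply, Fin.ext_iff]
  · rw [dif_neg (by exact hv), Pi.single_eq_of_ne]
    rintro rfl
    exact hv P.source.2

theorem sum_abs_padDist_le_one (hP : P.order = 1) (x : Fin n → Bool) {l : ℕ} (hl : l ≤ k * n) :
    ∑ v, |P.padDist x l v| ≤ 1 := by
  have h := P.padDist_add hP x (l := 0) (m := l) (by omega)
  rw [zero_add] at h
  rw [h]
  refine ((P.steps_subStochastic x 0 l).sum_abs_vecMul_le _).trans ?_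
  rw [padDist_zero]
  simp [Pi.single_apply, apply_ite abs]

theorem abs_acceptProb_sub_le (x y : Fin n → Bool) :
    |P.acceptProb x - P.acceptProb y| ≤
      ∑ v, |(P.padDist x (k * n) - P.padDist y (k * n)) v| := by
  unfold acceptProb
  rw [← Finset.sum_sub_distrib]
  refine (Finset.abs_sum_le_sum_abs _ _).trans ?_
  refine (Finset.sum_le_univ_sum_of_nonneg fun _ => abs_nonneg _).trans_eq ?_
  rw [← sum_fin_dite (P.size_le_bound _)]
  refine Finset.sum_congr rfl fun v _ => ?_
  simp only [Pi.sub_apply, padDist]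
  rw [dif_pos (show k * n < k * n + 1 by omega), dif_pos (show k * n < k * n + 1 by omega)]
  by_cases hv : (v : ℕ) < P.size (Fin.last (k * n))
  · have hv' : (v : ℕ) < P.size ⟨k * n, by omega⟩ := hv
    rw [dif_pos hv, dif_pos hv', dif_pos hv']
    rfl
  · have hv' : ¬ (v : ℕ) < P.size ⟨k * n, by omega⟩ := hv
    rw [dif_neg hv, dif_neg hv', dif_neg hv']
    simp

theorem width_le_bound : P.width ≤ P.bound := Nat.le_add_right _ _

theorem source_lt_width (h : 0 < k * n) : (P.source : ℕ) < P.width :=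
  P.source.2.trans_le (P.size_le_width 0 h)

/-- The level reached is not the sink level, so its size is bounded by the width and only that many
columns contribute. -/
theorem sum_abs_steps_sub_le {x y : Fin n → Bool} {l c : ℕ} (hc : 0 < c) (hl : l + c < k * n)
    {δ : ℝ} (v : Fin P.bound)
    (h : ∀ u : Fin P.bound, (u : ℕ) < P.width →
      |P.steps x l c v u - P.steps y l c v u| ≤ δ) :
    ∑ u, |P.steps x l c v u - P.steps y l c v u| ≤ P.width * δ := by
  calc _ ≤ ∑ u : Fin P.bound, (if _ : (u : ℕ) < P.width then δ else 0) := by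
        refine Finset.sum_le_sum fun u _ => ?_
        split_ifs with hu
        · exact h u hu
        · rw [P.steps_apply_eq_zero_right x hc hl v (not_lt.mp hu),
            P.steps_apply_eq_zero_right y hc hl v (not_lt.mp hu)]
          simp
    _ = P.width * δ := by
        rw [sum_fin_dite P.width_le_bound (fun _ => δ)]
        simp

/-- Two inputs which agree from position `c` on, and for which the first `c` steps of each layer
have close transition probabilities, are accepted with close probabilities. -/
theorem abs_acceptProb_sub_le_of_close (hP : P.order = 1) {x y : Fin n → Bool} {c : ℕ} (hc : 0 < c)
    (hcn : c < n) (hxy : ∀ m, c ≤ m → inputBit x m = inputBit y m) {δ : ℝ} (hδ : 0 ≤ δ)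
    (h : ∀ r < k, ∀ v u : Fin P.bound, (v : ℕ) < P.width → (u : ℕ) < P.width →
      (r = 0 → (v : ℕ) = P.source) →
      |P.steps x (r * n) c v u - P.steps y (r * n) c v u| ≤ δ) :
    |P.acceptProb x - P.acceptProb y| ≤ k * (P.width * δ) := by
  refine (P.abs_acceptProb_sub_le x y).trans ?_
  have main : ∀ r ≤ k, ∑ v, |(P.padDist x (r * n) - P.padDist y (r * n)) v| ≤
      r * (P.width * δ) := by
    intro r
    induction r with
    | zero => intro _; simp [padDist_zero]
    | succ r ih =>
      intro hr
      have hrn : (r + 1) * n ≤ k * n := Nat.mul_le_mul_right _ hr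
      have e : (r + 1) * n = r * n + c + (n - c) := by rw [add_mul, one_mul]; omega
      -- The remainder of the layer reads only positions from `c` on, where the inputs agree.
      have hB : P.steps x (r * n + c) (n - c) = P.steps y (r * n + c) (n - c) := by
        refine P.steps_congr fun i hi => hxy _ ?_
        rw [show r * n + c + i = c + i + n * r by ring, Nat.add_mul_mod_self_left,
          Nat.mod_eq_of_lt (by omega)]
        omega
      have hAlice : ∑ v, |(P.padDist x (r * n + c) - P.padDist y (r * n + c)) v| ≤
          r * (P.width * δ) + P.width * δ := by
        rw [P.padDist_add hP x (by omega), P.padDist_add hP y (by omega)]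
        refine ((P.steps_subStochastic x _ _).sum_abs_vecMul_sub_le (by positivity)
          (P.sum_abs_padDist_le_one hP y (by omega)) fun v hv => ?_).trans
          (add_le_add (ih (by omega)) le_rfl)
        by_cases hvw : (v : ℕ) < P.width
        · refine P.sum_abs_steps_sub_le hc (by omega) v fun u hu =>
            h r (by omega) v u hvw hu ?_
          -- At level `0` the distribution is a point mass, so in the first layer only the source
          -- row matters.
          rintro rfl
          rw [zero_mul, padDist_zero] at hv
          by_contra hne
          refine hv (Pi.single_eq_of_ne ?_ _)
          rintro rfl
          exact hne rfl
        · have h0 : ∀ z : Fin n → Bool, ∀ u, P.steps z (r * n) c v u = 0 := fun z u =>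
            P.steps_apply_eq_zero_left z hc (by omega) (not_lt.mp hvw) u
          simp only [h0, sub_zero, abs_zero, Finset.sum_const_zero]
          positivity
      rw [e, P.padDist_add hP x (by omega), P.padDist_add hP y (by omega), hB,
        ← Matrix.sub_vecMul]
      refine ((P.steps_subStochastic y _ _).sum_abs_vecMul_le _).trans (hAlice.trans_eq ?_)
      push_cast; ring
  exact main k le_rfl

end POBDD

/-! ### Counting -/

/-- The precision to which the transition probabilities are rounded. -/
noncomputable def precision (ε : ℝ) (k w : ℕ) : ℕ := ⌊(k * w : ℝ) / (2 * ε)⌋₊ + 1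

theorem mul_inv_precision_lt {ε : ℝ} (hε : 0 < ε) (k w : ℕ) :
    (k : ℝ) * (w * (precision ε k w : ℝ)⁻¹) < 2 * ε := by
  have h : (k * w : ℝ) / (2 * ε) < precision ε k w := by
    unfold precision; push_cast; exact Nat.lt_floor_add_one _
  have h0 : (0 : ℝ) < precision ε k w := by unfold precision; positivity
  rw [div_lt_iff₀ (by positivity)] at h
  rw [← mul_assoc, ← div_eq_mul_inv, div_lt_iff₀ h0]
  linarith

theorem logb_precision_succ_le {ε : ℝ} (hε : 0 < ε) {k w : ℕ} (hk : 0 < k) (hw : 0 < w) :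
    Real.logb 2 (precision ε k w + 1) ≤
      Real.logb 2 (1 / (2 * ε) + 2) + Real.logb 2 k + Real.logb 2 w := by
  have hk' : (1 : ℝ) ≤ k := by exact_mod_cast hk
  have hw' : (1 : ℝ) ≤ w := by exact_mod_cast hw
  have hkw : (1 : ℝ) ≤ k * w := one_le_mul_of_one_le_of_one_le hk' hw'
  have hC : (0 : ℝ) < 1 / (2 * ε) + 2 := by positivity
  rw [← Real.logb_mul hC.ne' (by positivity), ← Real.logb_mul (by positivity) (by positivity)]
  refine Real.logb_le_logb_of_le one_lt_two (by positivity) ?_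
  have h := Nat.floor_le (show 0 ≤ (k * w : ℝ) / (2 * ε) by positivity)
  unfold precision
  push_cast
  have e : (1 / (2 * ε) + 2) * k * w = (k * w : ℝ) / (2 * ε) + 2 * (k * w) := by ring
  rw [e]
  linarith

/-- Here `L = log d`, `l = log k`, `K = k - 1`, `q` is the logarithm of the number of rounded values
and `m = ⌊log d⌋`. Counting one row for the first layer is essential: for `k = 2`, a full matrix
there would double the main term and use up the factor `1 / 2` gained from `log w ≤ L / 2`. -/
theorem pow_precision_lt_aux {c L K d w l q m : ℝ} (hL : 8 + 3 * c ≤ L) (hc : 1 ≤ c) (hK : 1 ≤ K)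
    (hd : 64 ≤ d) (hw : 1 ≤ w) (hl : 1 ≤ l) (hwl : w ^ 2 * l ≤ d) (hq : q ≤ c + l + L / 2)
    (hm : L - 1 ≤ m) : (w + K * w ^ 2) * q < m * (K * (d - 2)) := by
  have hwd : w ^ 2 ≤ d := (le_mul_of_one_le_right (by positivity) hl).trans hwl
  -- Since `64 ≤ d`, `w ^ 2 ≤ d ≤ (d / 8) ^ 2`.
  have hw8 : w ≤ d / 8 := by
    refine abs_le_of_sq_le_sq' ?_ (by positivity) |>.2
    nlinarith
  have hww : w * l ≤ d := by
    refine le_trans (mul_le_mul_of_nonneg_right ?_ (by positivity)) hwl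
    nlinarith
  have hA : 0 ≤ w + K * w ^ 2 := by positivity
  have hKd : 0 < K * d := by positivity
  have hdK : d ≤ K * d := le_mul_of_one_le_left (by positivity) hK
  have h1 : (w + K * w ^ 2) * l ≤ 2 * (K * d) := by
    have := mul_le_mul_of_nonneg_left hwl (show 0 ≤ K by positivity)
    linarith [add_mul w (K * w ^ 2) l, mul_assoc K (w ^ 2) l]
  have h2 : w + K * w ^ 2 ≤ 9 / 8 * (K * d) := by
    have := mul_le_mul_of_nonneg_left hwd (show 0 ≤ K by positivity)
    linarith
  have h3 : (w + K * w ^ 2) * (c + L / 2) ≤ 9 / 8 * (K * d) * (c + L / 2) :=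
    mul_le_mul_of_nonneg_right h2 (by linarith)
  have h4 : (w + K * w ^ 2) * q ≤ K * d * (2 + 9 / 8 * (c + L / 2)) := by
    have := mul_le_mul_of_nonneg_left hq hA
    linarith
  have h5 : K * d * (31 / 32 * (L - 1)) ≤ m * (K * (d - 2)) := by
    have e : K * d * (31 / 32 * (L - 1)) = (L - 1) * (K * (31 / 32 * d)) := by ring
    rw [e]
    refine mul_le_mul hm ?_ (by positivity) (by linarith)
    exact mul_le_mul_of_nonneg_left (by linarith) (by positivity)
  -- What remains is `95 + 36 * c < 13 * L`, which follows from `8 + 3 * c ≤ L`.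
  refine (h4.trans_lt (mul_lt_mul_of_pos_left ?_ hKd)).trans_le h5
  linarith

/-- For large `d` there are fewer rounded programs than tables. -/
theorem exists_pow_precision_lt {ε : ℝ} (hε : 0 < ε) :
    ∃ d₀ : ℕ, 64 ≤ d₀ ∧ ∀ d k w : ℕ, d₀ ≤ d → 2 ≤ k → 0 < w →
      (w : ℝ) ≤ Real.sqrt ((d : ℝ) / Real.logb 2 (k : ℝ)) →
      (precision ε k w + 1) ^ (w + (k - 1) * (w * w)) <
        (2 ^ Nat.log 2 d) ^ ((k - 1) * (d - 2)) := by
  set c := Real.logb 2 (1 / (2 * ε) + 2) with hc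
  have hc1 : 1 ≤ c := by
    rw [hc, Real.le_logb_iff_rpow_le one_lt_two (by positivity), Real.rpow_one]
    have : 0 < 1 / (2 * ε) := by positivity
    linarith
  refine ⟨max 64 ⌈(2 : ℝ) ^ (8 + 3 * c)⌉₊, le_max_left _ _, fun d k w hd hk hw hwd => ?_⟩
  have hd64 : 64 ≤ d := (le_max_left _ _).trans hd
  have hd64' : (64 : ℝ) ≤ d := by exact_mod_cast hd64
  have hL : 8 + 3 * c ≤ Real.logb 2 d := by
    rw [Real.le_logb_iff_rpow_le one_lt_two (by positivity)]
    exact Nat.ceil_le.mp ((le_max_right _ _).trans hd)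
  have hk' : (2 : ℝ) ≤ k := by exact_mod_cast hk
  have hl : 1 ≤ Real.logb 2 k := by
    rwa [Real.le_logb_iff_rpow_le one_lt_two (by positivity), Real.rpow_one]
  have hw' : (1 : ℝ) ≤ w := by exact_mod_cast hw
  have hwl : (w : ℝ) ^ 2 * Real.logb 2 k ≤ d := by
    have := (Real.le_sqrt' (by positivity)).mp hwd
    rwa [le_div_iff₀ (by positivity)] at this
  have hlw : Real.logb 2 w ≤ Real.logb 2 d / 2 := by
    have h : Real.logb 2 ((w : ℝ) ^ 2) ≤ Real.logb 2 d :=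
      Real.logb_le_logb_of_le one_lt_two (by positivity)
        ((le_mul_of_one_le_right (by positivity) hl).trans hwl)
    rw [Real.logb_pow] at h
    push_cast at h
    linarith
  have hq := logb_precision_succ_le hε (show 0 < k by omega) hw
  have hm : Real.logb 2 d - 1 ≤ Nat.log 2 d := by
    have h : (d : ℝ) ≤ 2 ^ (Nat.log 2 d + 1) := by
      exact_mod_cast (Nat.lt_pow_succ_log_self one_lt_two d).le
    have := Real.logb_le_logb_of_le one_lt_two (by positivity) h
    rw [Real.logb_pow, Real.logb_self_eq_one one_lt_two] at this
    push_cast at this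
    linarith
  have hK : (1 : ℝ) ≤ ((k - 1 : ℕ) : ℝ) := by exact_mod_cast (show 1 ≤ k - 1 by omega)
  have key := pow_precision_lt_aux hL hc1 hK hd64' hw' hl hwl
    (hq.trans (by linarith)) hm
  have hreal : ((precision ε k w : ℝ) + 1) ^ (w + (k - 1) * (w * w)) <
      ((2 : ℝ) ^ Nat.log 2 d) ^ ((k - 1) * (d - 2)) := by
    rw [← Real.logb_lt_logb_iff one_lt_two (by positivity) (by positivity), Real.logb_pow,
      Real.logb_pow, Real.logb_pow, Real.logb_self_eq_one one_lt_two]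
    have e : ((d - 2 : ℕ) : ℝ) = d - 2 := by
      rw [Nat.cast_sub (by omega)]; norm_num
    push_cast [e]
    linarith
  exact_mod_cast hreal

/-- The table of the first player with the values `g`, extended by zero. -/
def tableOf {k d m : ℕ} (g : Fin (k - 1) × Fin (d - 2) → Fin (2 ^ m)) (i v : ℕ) : ℕ :=
  if h : (0 < i ∧ i < k) ∧ 0 < v ∧ v + 1 < d then
    g (⟨i - 1, by omega⟩, ⟨v - 1, by omega⟩) else 0

theorem tableOf_injective {k d m : ℕ} :
    Function.Injective (tableOf : (Fin (k - 1) × Fin (d - 2) → Fin (2 ^ m)) → ℕ → ℕ → ℕ) := by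
  intro g g' h
  funext ⟨i, v⟩
  have := congrFun (congrFun h (i + 1)) (v + 1)
  have hi := i.2
  have hv := v.2
  unfold tableOf at this
  rw [dif_pos ⟨by omega, by omega⟩, dif_pos ⟨by omega, by omega⟩] at this
  simpa [Fin.ext_iff] using this

theorem tableOf_lt {k d m : ℕ} (g : Fin (k - 1) × Fin (d - 2) → Fin (2 ^ m)) (i v : ℕ) :
    tableOf g i v < 2 ^ m := by
  unfold tableOf
  split_ifs
  exacts [(g _).2, Nat.two_pow_pos m]

theorem exists_MXPJ_tableOf_ne {k d n m : ℕ} (hd : 2 ≤ d) (hm : 2 ^ m ≤ d)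
    (hn : 2 * k * d * Nat.clog 2 d ≤ n) {g g' : Fin (k - 1) × Fin (d - 2) → Fin (2 ^ m)}
    (hne : g ≠ g') : ∃ fB : ℕ → ℕ → ℕ,
      MXPJ k d n (encode d n (tables k d (tableOf g) fB)) ≠
        MXPJ k d n (encode d n (tables k d (tableOf g') fB)) := by
  obtain ⟨fB, hB, h⟩ := exists_tables_parity_ne (k := k) (fA := tableOf g) (gA := tableOf g') hm
    (fun i => dif_neg (by omega)) (fun i => dif_neg (by omega)) (tableOf_lt g) (tableOf_lt g')
    (funext fun v => by simp [tableOf])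
    (fun i hi => funext fun v => by
      rw [tableOf, tableOf, dif_neg (by omega), dif_neg (by omega)])
    (fun i v hv => by rw [tableOf, tableOf, dif_neg (by omega), dif_neg (by omega)])
    (tableOf_injective.ne hne)
  refine ⟨fB, ?_⟩
  rw [MXPJ_encode_tables hd hn (fun i v => (tableOf_lt g i v).trans_le hm) hB,
    MXPJ_encode_tables hd hn (fun i v => (tableOf_lt g' i v).trans_le hm) hB]
  intro e
  have := decide_eq_decide.mp e
  tauto

theorem abs_sub_le_inv_of_floor_eq {M : ℕ} (hM : 0 < M) {a b : ℝ} (ha : 0 ≤ a) (hb : 0 ≤ b)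
    (h : ⌊M * a⌋₊ = ⌊M * b⌋₊) : |a - b| ≤ (M : ℝ)⁻¹ := by
  have hM' : (0 : ℝ) < M := by exact_mod_cast hM
  have a1 := Nat.floor_le (show 0 ≤ M * a by positivity)
  have a2 := Nat.lt_floor_add_one (M * a)
  have b1 := Nat.floor_le (show 0 ≤ M * b by positivity)
  have b2 := Nat.lt_floor_add_one (M * b)
  rw [h] at a1 a2
  have : |M * a - M * b| ≤ 1 := abs_le.mpr ⟨by linarith, by linarith⟩
  rw [← mul_sub, abs_mul, abs_of_pos hM'] at this
  rwa [← mul_le_mul_iff_right₀ hM', mul_inv_cancel₀ hM'.ne']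

/-! ### Rounded transition matrices and the collision argument -/

namespace POBDD

variable {k n : ℕ} (P : POBDD k n)

theorem width_pos (h : 0 < k * n) : 0 < P.width :=
  (Nat.zero_le _).trans_lt (P.source_lt_width h)

/-- An entry of the product of the first `c` transition matrices of a layer, rounded. -/
noncomputable def roundedEntry (M c : ℕ) (x : Fin n → Bool) (r : ℕ) (v u : Fin P.bound) :
    Fin (M + 1) :=
  ⟨⌊M * P.steps x (r * n) c v u⌋₊, Nat.lt_succ_of_le (Nat.floor_le_of_le
    (mul_le_of_le_one_right (Nat.cast_nonneg M) ((P.steps_subStochastic x _ _).le_one v u)))⟩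

/-- The rounded transition probabilities of the first `c` steps of all layers; in the first layer
only those from the source are relevant. -/
noncomputable def roundedSteps (M c : ℕ) (x : Fin n → Bool) :
    Fin P.width ⊕ Fin (k - 1) × (Fin P.width × Fin P.width) → Fin (M + 1)
  | .inl u => P.roundedEntry M c x 0 (Fin.castLE (P.size_le_bound 0) P.source)
      (Fin.castLE P.width_le_bound u)
  | .inr (r, v, u) => P.roundedEntry M c x (r + 1) (Fin.castLE P.width_le_bound v)
      (Fin.castLE P.width_le_bound u)

theorem roundedSteps_congr {M c : ℕ} (hcn : c ≤ n) {x y : Fin n → Bool}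
    (h : ∀ m < c, inputBit x m = inputBit y m) : P.roundedSteps M c x = P.roundedSteps M c y := by
  have hs : ∀ r, P.steps x (r * n) c = P.steps y (r * n) c := fun r => by
    refine P.steps_congr fun i hi => ?_
    rw [add_comm, Nat.add_mul_mod_self_right, Nat.mod_eq_of_lt (by omega)]
    exact h i hi
  funext i
  rcases i with u | ⟨r, v, u⟩ <;> simp only [roundedSteps, roundedEntry, hs]

theorem abs_acceptProb_sub_le_of_roundedSteps_eq (hP : P.order = 1) {x y : Fin n → Bool}
    {M c : ℕ} (hM : 0 < M) (hc : 0 < c) (hcn : c < n)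
    (hxy : ∀ m, c ≤ m → inputBit x m = inputBit y m)
    (h : P.roundedSteps M c x = P.roundedSteps M c y) :
    |P.acceptProb x - P.acceptProb y| ≤ k * (P.width * (M : ℝ)⁻¹) := by
  refine P.abs_acceptProb_sub_le_of_close hP hc hcn hxy (by positivity) ?_
  intro r hr v u hv hu h0
  refine abs_sub_le_inv_of_floor_eq hM ((P.steps_subStochastic x _ _).nonneg v u)
    ((P.steps_subStochastic y _ _).nonneg v u) ?_
  rcases r with _ | r
  · obtain rfl : v = Fin.castLE (P.size_le_bound 0) P.source := Fin.ext (h0 rfl)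
    exact Fin.ext_iff.mp (congrFun h (.inl ⟨u, hu⟩))
  · exact Fin.ext_iff.mp (congrFun h (.inr (⟨r, by omega⟩, ⟨v, hv⟩, ⟨u, hu⟩)))

theorem ComputesWithError.two_mul_le {P : POBDD k n} {f : (Fin n → Bool) → Bool} {ε : ℝ}
    (h : P.ComputesWithError f ε) {x y : Fin n → Bool} (hxy : f x ≠ f y) :
    2 * ε ≤ |P.acceptProb x - P.acceptProb y| := by
  have hx := h x
  have hy := h y
  cases hfx : f x <;> cases hfy : f y
  · simp [hfx, hfy] at hxy
  · rw [abs_sub_comm]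
    exact le_trans (by linarith [hx.2 hfx, hy.1 hfy]) (le_abs_self _)
  · exact le_trans (by linarith [hx.1 hfx, hy.2 hfy]) (le_abs_self _)
  · simp [hfx, hfy] at hxy

end POBDD

theorem mainTheorem9 (ε : ℝ) (hε : 0 < ε) :
    ∃ d₀ : ℕ, ∀ d k n : ℕ, d₀ ≤ d → 2 ≤ k → 2 * k * d * Nat.clog 2 d ≤ n →
      MXPJ k d n ∉ kIdPOBDD k n (Real.sqrt ((d : ℝ) / Real.logb 2 (k : ℝ))) ε := by
  obtain ⟨d₀, h64, hd₀⟩ := exists_pow_precision_lt hε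
  refine ⟨d₀, fun d k n hd hk hn => ?_⟩
  rintro ⟨P, hP, hw, hcomp⟩
  have hd2 : 2 ≤ d := by omega
  have ht : 0 < Nat.clog 2 d := Nat.clog_pos one_lt_two hd2
  set c := k * d * Nat.clog 2 d with hc
  have hc0 : 0 < c := by positivity
  have hcn : c < n := by
    have : 2 * k * d * Nat.clog 2 d = c + c := by rw [hc]; ring
    omega
  have hwpos := P.width_pos (Nat.mul_pos (show 0 < k by omega) (show 0 < n by omega))
  have hcard := hd₀ d k P.width hd hk hwpos hw
  set M := precision ε k P.width with hM
  have hM0 : 0 < M := Nat.succ_pos _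
  have hm : 2 ^ Nat.log 2 d ≤ d := Nat.pow_log_le_self 2 (by omega)
  -- The second player's tables `0` are placeholders: the rounding depends only on the bits before
  -- `c`, so the collision persists for the `fB` chosen afterwards.
  obtain ⟨g, g', hne, heq⟩ := Fintype.exists_ne_map_eq_of_card_lt
    (fun g : Fin (k - 1) × Fin (d - 2) → Fin (2 ^ Nat.log 2 d) =>
      P.roundedSteps M c (encode d n (tables k d (tableOf g) 0))) (by simpa using hcard)
  obtain ⟨fB, hfB⟩ := exists_MXPJ_tableOf_ne hd2 hm hn hne
  have hcell : ∀ g : Fin (k - 1) × Fin (d - 2) → Fin (2 ^ Nat.log 2 d),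
      P.roundedSteps M c (encode d n (tables k d (tableOf g) fB)) =
        P.roundedSteps M c (encode d n (tables k d (tableOf g) 0)) := fun g =>
    P.roundedSteps_congr hcn.le fun m hm => inputBit_encode_tables_left _ _ _ hm
  have hle := P.abs_acceptProb_sub_le_of_roundedSteps_eq hP hM0 hc0 hcn
    (fun m hm => inputBit_encode_tables_right hd2 (tableOf g) (tableOf g') fB hm)
    ((hcell g).trans (heq.trans (hcell g').symm))
  exact absurd (hcomp.two_mul_le hfB)
    (not_le.mpr (hle.trans_lt (mul_inv_precision_lt hε k P.width)))
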